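/- Let $G$ be a hyperbolic group, i.e. a finitely generated group such that, in its Cayley graph with respect to some (equivalently, every) finite generating set, all geodesic triangles are $\delta$-slim for some $\delta$. A group $L$ is called a $G$-limit group if $L$ is finitely generated and fully residually $G$, i.e. for every finite subset $X\subset L$ there is a homomorphism $f:L\to G$ that is injective on $X$. For $g\in G$ of infinite order, let $M(g)$ denote the unique maximal virtually abelian subgroup of $G$ containing $g$ (it exists since $G$ is hyperbolic). Suppose that $G$ is torsion-saturated, i.e. that the following two conditions hold. 1. For every isomorphism $\alpha:F_1\to F_2$ between finite subgroups $F_1,F_2$ of $G$, there exists $g\in G$ such that $gxg^{-1}=\alpha(x)$ for every $x\in F_1$. 2. For every finite subgroup $F$ of $G$, there exists an infinite subset $\{g_1,g_2,\ldots\}$ of $G$ such that every $g_n$ has infinite order, $M(g_n)=\langle g_n\rangle\times F$ (internal direct product) for every $n$, and $M(g_n)\neq M(g_m)$ whenever $n\neq m$. Then the class of $G$-limit groups is closed under HNN extensions and amalgamated free products over finite groups: (a) if $H$ is a $G$-limit group and $\alpha:F_1\to F_2$ is an isomorphism between finite subgroups $F_1,F_2$ of $H$, then the HNN extension $H\ast_\alpha=\langle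 H,t \mid txt^{-1}=\alpha(x)\ \text{for all } x\in F_1\rangle$ is a $G$-limit group; (b) if $A$ and $B$ are $G$-limit groups and $F$ is a finite group with injective homomorphisms $F\to A$ and $F\to B$, then the amalgamated free product $A\ast_F B$ is a $G$-limit group. -/

import Mathlib

universe u v w

/-- `G` is hyperbolic (in the sense of Gromov): it has a finite generating set `S`, and for some
`δ` the geodesic triangles of the Cayley graph of `G` with respect to `S` are `δ`-slim, that is,
every vertex on one side is at distance at most `δ` from a vertex on one of the two others. A
geodesic is a walk whose length is the distance of its endpoints; the sides of a triangle are read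
cyclically and the vertices are arbitrary, so it is enough to speak of the first side. -/
def IsHyperbolicGroup (G : Type*) [Group G] : Prop :=
  ∃ S : Set G, S.Finite ∧ Subgroup.closure S = ⊤ ∧
    ∃ δ : ℕ, ∀ (x y z : G)
      (p : (SimpleGraph.mulCayley S).Walk x y)
      (q : (SimpleGraph.mulCayley S).Walk y z)
      (r : (SimpleGraph.mulCayley S).Walk z x),
      p.length = (SimpleGraph.mulCayley S).dist x y →
      q.length = (SimpleGraph.mulCayley S).dist y z →
      r.length = (SimpleGraph.mulCayley S).dist z x →
      ∀ v ∈ p.support, ∃ w, (w ∈ q.support ∨ w ∈ r.support) ∧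
        (SimpleGraph.mulCayley S).dist v w ≤ δ

/-- A group is virtually abelian if it has an abelian subgroup of finite index. -/
def IsVirtuallyAbelian (G : Type*) [Group G] : Prop :=
  ∃ A : Subgroup G, A.FiniteIndex ∧ ∀ a ∈ A, ∀ b ∈ A, a * b = b * a

/-- `M = M(g)`: the subgroup `M` is the unique maximal virtually abelian subgroup of `G`
that contains `g`. (In a hyperbolic group it exists for every `g` of infinite order.) -/
structure IsMaximalVirtuallyAbelianOf {G : Type*} [Group G] (g : G) (M : Subgroup G) : Prop where
  maximal : Maximal (fun K : Subgroup G => IsVirtuallyAbelian K) M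
  mem : g ∈ M
  unique : ∀ N : Subgroup G,
    Maximal (fun K : Subgroup G => IsVirtuallyAbelian K) N → g ∈ N → N = M

/-- `M = A × B` as an internal direct product of subgroups. -/
structure IsInternalDirectProduct {G : Type*} [Group G] (M A B : Subgroup G) : Prop where
  commute : ∀ a ∈ A, ∀ b ∈ B, a * b = b * a
  disjoint : A ⊓ B = ⊥
  sup_eq : A ⊔ B = M

/-- Torsion-saturated groups. -/
structure IsTorsionSaturated (G : Type*) [Group G] : Prop where
  /-- Isomorphisms between finite subgroups are induced by conjugations. -/
  conj : ∀ (F₁ F₂ : Subgroup G), Finite F₁ → Finite F₂ → ∀ α : F₁ ≃* F₂,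
    ∃ g : G, ∀ x : F₁, g * (x : G) * g⁻¹ = (α x : G)
  /-- For every finite subgroup `F` there are infinitely many `g` of infinite order
  with `M(g) = ⟨g⟩ × F`, the subgroups `M(g)` being pairwise distinct. -/
  exists_infinite : ∀ F : Subgroup G, Finite F →
    ∃ E : Set G, E.Infinite ∧ ∃ M : G → Subgroup G,
      (∀ g ∈ E, ¬ IsOfFinOrder g ∧ IsMaximalVirtuallyAbelianOf g (M g) ∧
        IsInternalDirectProduct (M g) (Subgroup.zpowers g) F) ∧
      ∀ g ∈ E, ∀ h ∈ E, g ≠ h → M g ≠ M h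

/-- `L` is fully residually `G`: every finite subset of `L` is mapped injectively by some
homomorphism from `L` to `G`. -/
def IsFullyResidually (G L : Type*) [Group G] [Group L] : Prop :=
  ∀ X : Set L, X.Finite → ∃ f : L →* G, Set.InjOn f X

/-- `L` is a `G`-limit group: it is finitely generated and fully residually `G`. -/
def IsLimitGroup (G L : Type*) [Group G] [Group L] : Prop :=
  Group.FG L ∧ IsFullyResidually G L

/-- The two-term family consisting of `A` (at `false`) and `B` (at `true`). -/
def AmalgamFactor (A B : Type u) : Bool → Type u
  | false => A
  | true => B

instance AmalgamFactor.instGroup (A B : Type u) [Group A] [Group B] :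
    ∀ b : Bool, Group (AmalgamFactor A B b)
  | false => inferInstanceAs (Group A)
  | true => inferInstanceAs (Group B)

/-- The maps `i : F → A` and `j : F → B` as one family of homomorphisms. -/
def AmalgamFactor.map {F : Type v} {A B : Type u} [Group F] [Group A] [Group B]
    (i : F →* A) (j : F →* B) : ∀ b : Bool, F →* AmalgamFactor A B b
  | false => i
  | true => j

/-- The amalgamated free product `A ∗_F B` along `i : F → A` and `j : F → B`, as the pushout
in the category of groups. -/
abbrev AmalgamatedProduct {F : Type v} {A B : Type u} [Group F] [Group A] [Group B]
    (i : F →* A) (j : F →* B) :=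
  Monoid.PushoutI (AmalgamFactor.map i j)

/-! Write finitely many nontrivial elements of the HNN extension or amalgam as reduced words, and
take homomorphisms to `G` from the limit groups that are injective on the letters and on the finite
edge groups. Condition 1 makes them compatible along the edge group, whose image is called `F` here.
There remains the freedom to twist by any `s` centralizing `F`: on the stable letter, or by
conjugating one factor. Up to finitely many outer factors, images of reduced words become products
of `s ^ (±1)` separated by elements of a finite set `U` disjoint from `F`, apart from short words
containing no `s`. So everything rests on `IsTorsionSaturated.exists_separating`: some `s` keeps all
such products off a given finite set.

This is where hyperbolicity and condition 2 enter. The group `M(g) = ⟨g⟩ × F` is the commensurator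
of `⟨g⟩` (`cyclicCommensurator_eq`), so an element outside `F` lies in at most one of the distinct
`M(g)`, and some `M(g)` misses `U`. Then `u⟨g⟩` and `⟨g⟩` diverge for `u ∈ U`
(`exists_gromovProduct_le`). For `s` a large power of `g`, the products trace broken geodesics with
long pieces and small Gromov products at the corners, hence end far from `1` (`lt_dist_one_prod`).
-/

/-- A left-invariant, proper, integer-valued metric on a group, in which points can be
interpolated and which satisfies Gromov's four-point condition with constant `c`. -/
structure IsHyperbolicMetric {G : Type*} [Group G] (d : G → G → ℤ) (c : ℤ) : Prop where
  self : ∀ x, d x x = 0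
  symm : ∀ x y, d x y = d y x
  triangle : ∀ x y z, d x z ≤ d x y + d y z
  mul_left : ∀ g x y, d (g * x) (g * y) = d x y
  finite_ball : ∀ r, {g | d 1 g ≤ r}.Finite
  interpolate : ∀ x y k, 0 ≤ k → k ≤ d x y → ∃ p, d x p = k ∧ d p y = d x y - k
  four_point : ∀ w x y z, d x z + d w y ≤ d x y + d w z + c ∨ d x z + d w y ≤ d y z + d w x + c

/-! ### From slim triangles in the Cayley graph to the four-point condition -/

section CayleyGraph

variable {G : Type*} [Group G] {S : Set G}

theorem SimpleGraph.mulCayley_connected (hS : Subgroup.closure S = ⊤) :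
    (SimpleGraph.mulCayley S).Connected := by
  have key : ∀ g : G, ∀ x, (SimpleGraph.mulCayley S).Reachable x (x * g) := by
    intro g
    have hg : g ∈ Subgroup.closure S := hS ▸ Subgroup.mem_top g
    induction hg using Subgroup.closure_induction with
    | mem s hs =>
      intro x
      by_cases h : x = x * s
      · rw [← h]
      · exact SimpleGraph.Adj.reachable
          ((SimpleGraph.mulCayley_adj' S _ _).2 ⟨h, s, hs, Or.inl rfl⟩)
    | one => intro x; simp
    | mul a b _ _ ha hb =>
      intro x
      rw [← mul_assoc]
      exact (ha x).trans (hb (x * a))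
    | inv a _ ha =>
      intro x
      simpa using (ha (x * a⁻¹)).symm
  have : Nonempty G := ⟨1⟩
  refine SimpleGraph.Connected.mk fun x y => ?_
  simpa using key (x⁻¹ * y) x

theorem SimpleGraph.mulCayley_dist_mul_left (hS : Subgroup.closure S = ⊤) (g x y : G) :
    (SimpleGraph.mulCayley S).dist (g * x) (g * y) = (SimpleGraph.mulCayley S).dist x y := by
  have key : ∀ g x y : G, (SimpleGraph.mulCayley S).dist (g * x) (g * y) ≤
      (SimpleGraph.mulCayley S).dist x y := by
    intro g x y
    obtain ⟨p, hp⟩ := (SimpleGraph.mulCayley_connected hS).exists_walk_length_eq_dist x y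
    let f : SimpleGraph.mulCayley S →g SimpleGraph.mulCayley S :=
      ⟨fun x => g * x, fun h => SimpleGraph.mulCayley_adj_mul_iff_right.2 h⟩
    rw [← hp, ← SimpleGraph.Walk.length_map f p]
    exact SimpleGraph.dist_le (p.map f)
  apply le_antisymm (key g x y)
  simpa using key g⁻¹ (g * x) (g * y)

theorem SimpleGraph.mulCayley_finite_ball (hfin : S.Finite) (hS : Subgroup.closure S = ⊤) (r : ℕ) :
    {g | (SimpleGraph.mulCayley S).dist 1 g ≤ r}.Finite := by
  induction r with
  | zero =>
    refine (Set.finite_singleton (1 : G)).subset fun g hg => ?_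
    have : (SimpleGraph.mulCayley S).dist 1 g = 0 := Nat.le_zero.1 hg
    rw [(SimpleGraph.mulCayley_connected hS).dist_eq_zero_iff] at this
    exact this.symm
  | succ r ih =>
    have hT : (S ∪ S⁻¹).Finite := hfin.union hfin.inv
    refine (ih.union (ih.image2 (fun x s => x * s) hT)).subset fun g hg => ?_
    obtain ⟨p, hp⟩ := (SimpleGraph.mulCayley_connected hS).exists_walk_length_eq_dist 1 g
    rcases Nat.lt_or_ge r p.length with h | h
    · right
      have hlen : p.length = r + 1 := le_antisymm (hp ▸ hg) h
      have hadj : (SimpleGraph.mulCayley S).Adj (p.getVert r) (p.getVert (r + 1)) :=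
        p.adj_getVert_succ h
      rw [← hlen, p.getVert_length, SimpleGraph.mulCayley_adj] at hadj
      refine ⟨p.getVert r, ?_, (p.getVert r)⁻¹ * g, ?_, by simp⟩
      · have := SimpleGraph.dist_le (p.take r)
        rw [SimpleGraph.Walk.take_length] at this
        exact this.trans (min_le_left _ _)
      · rcases hadj.2 with h | h
        · exact Or.inl h
        · right
          simpa using h
    · left
      exact hp.symm.le.trans h

theorem SimpleGraph.Walk.dist_add_dist_of_mem_support {V : Type*} {X : SimpleGraph V} {x y p : V}
    (hX : X.Connected) (q : X.Walk x y) (hq : q.length = X.dist x y) (hp : p ∈ q.support) :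
    X.dist x p + X.dist p y = X.dist x y := by
  classical
  have h1 := SimpleGraph.dist_le (q.takeUntil p hp)
  have h2 := SimpleGraph.dist_le (q.dropUntil p hp)
  have h3 := congrArg SimpleGraph.Walk.length (q.take_spec hp)
  rw [SimpleGraph.Walk.length_append] at h3
  have h4 := hX.dist_triangle (u := x) (v := p) (w := y)
  omega

theorem IsHyperbolicGroup.exists_isHyperbolicMetric (hG : IsHyperbolicGroup G) :
    ∃ (d : G → G → ℤ) (c : ℤ), IsHyperbolicMetric d c := by
  obtain ⟨S, hfin, hS, δ, hδ⟩ := hG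
  have hX := SimpleGraph.mulCayley_connected hS
  set X := SimpleGraph.mulCayley S with hXdef
  have tri : ∀ x y z, X.dist x z ≤ X.dist x y + X.dist y z := fun x y z => hX.dist_triangle
  have symm : ∀ x y, X.dist x y = X.dist y x := fun x y => SimpleGraph.dist_comm
  have slim : ∀ x y z p, X.dist x p + X.dist p y = X.dist x y →
      ∃ q, (X.dist y q + X.dist q z = X.dist y z ∨ X.dist z q + X.dist q x = X.dist z x) ∧
        X.dist p q ≤ δ := by
    intro x y z p hp
    obtain ⟨a, ha⟩ := hX.exists_walk_length_eq_dist x p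
    obtain ⟨b, hb⟩ := hX.exists_walk_length_eq_dist p y
    obtain ⟨q, hq⟩ := hX.exists_walk_length_eq_dist y z
    obtain ⟨r, hr⟩ := hX.exists_walk_length_eq_dist z x
    obtain ⟨w, hw, hd⟩ := hδ x y z (a.append b) q r
      (by rw [SimpleGraph.Walk.length_append, ha, hb, hp]) hq hr p
      (by simp [SimpleGraph.Walk.mem_support_append_iff])
    exact ⟨w, hw.imp (q.dist_add_dist_of_mem_support hX hq) (r.dist_add_dist_of_mem_support hX hr),
      hd⟩
  -- Some vertex of `[x, y]` is as close to `w` as the Gromov product predicts, up to `2δ + 1`.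
  -- Otherwise, walking from `x`, no vertex can switch from being `δ`-close to `[w, x]` to being
  -- `δ`-close to `[y, w]`, so `y` itself is `δ`-close to `[w, x]`, which is absurd.
  have near : ∀ w x y, ∃ p, X.dist x p + X.dist p y = X.dist x y ∧
      2 * X.dist w p + X.dist x y ≤ X.dist w x + X.dist w y + (4 * δ + 2) := by
    intro w x y
    obtain ⟨g, hg⟩ := hX.exists_walk_length_eq_dist x y
    have hpt : ∀ k, X.dist x (g.getVert k) + X.dist (g.getVert k) y = X.dist x y := fun k =>
      g.dist_add_dist_of_mem_support hX hg (g.getVert_mem_support k)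
    by_contra hcon
    push Not at hcon
    have hall : ∀ k, k ≤ g.length →
        ∃ q, X.dist w q + X.dist q x = X.dist w x ∧ X.dist (g.getVert k) q ≤ δ := by
      intro k
      induction k with
      | zero => intro _; exact ⟨x, by simp⟩
      | succ k ih =>
        intro hk
        obtain ⟨q, hq, hqd⟩ := ih (by omega)
        obtain ⟨q', hq', hqd'⟩ := slim x y w (g.getVert (k + 1)) (hpt _)
        rcases hq' with hq' | hq'
        · exfalso
          have hadj := g.adj_getVert_succ (show k < g.length by omega)
          have h1 : X.dist (g.getVert k) (g.getVert (k + 1)) = 1 :=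
            SimpleGraph.dist_eq_one_iff_adj.2 hadj
          have := hcon _ (hpt k)
          have := hpt k
          have := tri x q (g.getVert k)
          have := tri w q (g.getVert k)
          have := tri w q' (g.getVert k)
          have := tri y q' (g.getVert k)
          have := tri (g.getVert k) (g.getVert (k + 1)) q'
          have := symm x q
          have := symm y q'
          have := symm y (g.getVert k)
          have := symm w q'
          have := symm w y
          have := symm q (g.getVert k)
          have := symm q' (g.getVert k)
          omega
        · exact ⟨q', hq', hqd'⟩
    obtain ⟨q, hq, hqd⟩ := hall g.length le_rfl
    rw [g.getVert_length] at hqd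
    have := hcon y (by simp)
    have := tri w q y
    have := tri x q y
    have := symm x q
    have := symm q y
    omega
  -- The constant is `4δ + 2` from `near`, plus `2δ` for moving the point of `[x, z]` to another
  -- side of the triangle `x, z, y`.
  refine ⟨fun x y => (X.dist x y : ℤ), 6 * δ + 2, ⟨by simp, fun x y => by rw [symm],
    fun x y z => by exact_mod_cast tri x y z,
    fun g x y => by exact_mod_cast SimpleGraph.mulCayley_dist_mul_left hS g x y, ?_, ?_, ?_⟩⟩
  · intro r
    refine (SimpleGraph.mulCayley_finite_ball hfin hS r.toNat).subset fun g hg => ?_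
    have h : (X.dist 1 g : ℤ) ≤ r := hg
    exact Int.ofNat_le.1 (h.trans (Int.self_le_toNat r))
  · intro x y k hk hk'
    obtain ⟨g, hg⟩ := hX.exists_walk_length_eq_dist x y
    have h1 := g.dist_add_dist_of_mem_support hX hg (g.getVert_mem_support k.toNat)
    have h2 := SimpleGraph.dist_le (g.take k.toNat)
    have h3 := SimpleGraph.dist_le (g.drop k.toNat)
    rw [SimpleGraph.Walk.take_length] at h2
    rw [SimpleGraph.Walk.drop_length] at h3
    exact ⟨g.getVert k.toNat, by omega, by omega⟩
  · intro w x y z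
    obtain ⟨p, hp, hpd⟩ := near w x z
    obtain ⟨q, hq, hqd⟩ := slim x z y p hp
    have := tri w p q
    have := tri w q y
    have := tri w q z
    have := tri w q x
    have := symm q x
    have := symm y q
    have := symm z q
    have := symm y z
    have := symm x y
    rcases hq with hq | hq <;> omega

end CayleyGraph

/-! ### Elementary hyperbolic geometry -/

namespace IsHyperbolicMetric

variable {G : Type*} [Group G] {d : G → G → ℤ} {c : ℤ}

theorem nonneg (hd : IsHyperbolicMetric d c) (x y : G) : 0 ≤ d x y := by
  have h1 := hd.triangle x y x
  have h2 := hd.self x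
  have h3 := hd.symm x y
  omega

theorem const_nonneg (hd : IsHyperbolicMetric d c) : 0 ≤ c := by
  have h1 := hd.four_point 1 1 1 1
  omega

theorem dist_mul_right (hd : IsHyperbolicMetric d c) (x y : G) : d x (x * y) = d 1 y := by
  simpa using hd.mul_left x 1 y

theorem dist_eq (hd : IsHyperbolicMetric d c) (x y : G) : d x y = d 1 (x⁻¹ * y) := by
  simpa using hd.dist_mul_right x (x⁻¹ * y)

theorem dist_one_inv (hd : IsHyperbolicMetric d c) (x : G) : d 1 x⁻¹ = d 1 x := by
  rw [hd.symm, hd.dist_eq]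
  simp

theorem exists_bound (_ : IsHyperbolicMetric d c) {B : Set G} (hB : B.Finite) :
    ∃ R, 0 ≤ R ∧ ∀ b ∈ B, d 1 b ≤ R := by
  obtain ⟨R, hR⟩ := (hB.image (d 1)).bddAbove
  exact ⟨max R 0, le_max_right _ _, fun b hb => (hR ⟨b, hb, rfl⟩).trans (le_max_left _ _)⟩

/-- Powers of an element of infinite order leave every ball. -/
theorem exists_zpow_gt (hd : IsHyperbolicMetric d c) {g : G} (hg : ¬ IsOfFinOrder g) {b : ℤ}
    (hb : b ≠ 0) (R : ℤ) : ∃ k : ℤ, R < d 1 (g ^ (b * k)) := by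
  by_contra hcon
  push Not at hcon
  refine Set.infinite_univ (α := ℤ) (Set.Finite.of_finite_image (f := fun k => g ^ (b * k))
    ((hd.finite_ball R).subset ?_) ?_)
  · rintro _ ⟨k, -, rfl⟩
    exact hcon k
  · intro k _ l _ h
    exact mul_left_cancel₀ hb (injective_zpow_iff_not_isOfFinOrder.2 hg h)

theorem fellow_travel (hd : IsHyperbolicMetric d c) {x y x' y' p p' : G} {r : ℤ}
    (hp : d x p + d p y = d x y) (hp' : d x' p' + d p' y' = d x' y') (h : d x p = d x' p')
    (hx : d x x' ≤ r) (hy : d y y' ≤ r) : d p p' ≤ 3 * r + c := by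
  have := hd.four_point x p y p'
  have := hd.triangle x x' p'
  have := hd.triangle y y' p'
  have := hd.triangle x' x y'
  have := hd.triangle x y y'
  have := hd.symm x x'
  have := hd.symm p' y'
  have := hd.nonneg x x'
  omega

theorem exists_near (hd : IsHyperbolicMetric d c) (p x y : G) :
    ∃ q, d x q + d q y = d x y ∧ 2 * d p q ≤ d p x + d p y - d x y + 2 * c + 1 := by
  have := hd.triangle p x y
  have := hd.triangle x y p
  have := hd.triangle x p y
  have := hd.symm p x
  have := hd.symm p y
  obtain ⟨q, hq, hq'⟩ := hd.interpolate x y ((d p x + d x y - d p y) / 2) (by omega) (by omega)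
  have := hd.four_point x p y q
  have := hd.symm q y
  exact ⟨q, by omega, by omega⟩

end IsHyperbolicMetric

/-! ### Quasiconvexity and commensurators of cyclic subgroups -/

/-- A subgroup is `κ`-quasiconvex if geodesics from `1` to its elements stay
`κ`-close to it. -/
def IsQuasiconvexWith {G : Type*} [Group G] (d : G → G → ℤ) (K : Subgroup G) (κ : ℤ) : Prop :=
  ∀ x ∈ K, ∀ p, d 1 p + d p x = d 1 x → ∃ q ∈ K, d p q ≤ κ

/-- The elements `h` that conjugate some nontrivial power of `g` to a nontrivial power of `g`. -/
def cyclicCommensurator {G : Type*} [Group G] (g : G) : Subgroup G where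
  carrier := {h | ∃ a b : ℤ, a ≠ 0 ∧ b ≠ 0 ∧ h * g ^ a = g ^ b * h}
  one_mem' := ⟨1, 1, one_ne_zero, one_ne_zero, by simp⟩
  mul_mem' := by
    rintro h k ⟨a, b, ha, hb, hab⟩ ⟨a', b', ha', hb', hab'⟩
    refine ⟨a' * a, b * b', mul_ne_zero ha' ha, mul_ne_zero hb hb', ?_⟩
    have h1 : SemiconjBy h (g ^ a) (g ^ b) := hab
    have h2 : SemiconjBy k (g ^ a') (g ^ b') := hab'
    have h3 := h1.zpow_right b'
    have h4 := h2.zpow_right a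
    rw [← zpow_mul, ← zpow_mul] at h3 h4
    rw [mul_comm a b'] at h3
    exact h3.mul_left h4
  inv_mem' := by
    rintro h ⟨a, b, ha, hb, hab⟩
    have h1 : SemiconjBy h (g ^ a) (g ^ b) := hab
    exact ⟨b, a, hb, ha, h1.inv_symm_left⟩

theorem IsVirtuallyAbelian.of_cover {G : Type*} [Group G] {A E : Subgroup G} {T : Set G}
    (hA : ∀ a ∈ A, ∀ b ∈ A, a * b = b * a) (hT : T.Finite)
    (h : ∀ x ∈ E, ∃ t ∈ T, t⁻¹ * x ∈ A) : IsVirtuallyAbelian E := by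
  refine ⟨A.subgroupOf E, ?_, fun a ha b hb => Subtype.ext (hA a ha b hb)⟩
  choose! t ht htA using h
  have : Finite T := hT
  have : Finite (E ⧸ A.subgroupOf E) := by
    let f : E ⧸ A.subgroupOf E → T := fun q => ⟨t (q.out : E), ht _ (q.out : E).2⟩
    refine Finite.of_injective f fun q q' hq => ?_
    have hq : t (q.out : E) = t (q'.out : E) := congrArg Subtype.val hq
    rw [← q.out_eq', ← q'.out_eq', QuotientGroup.eq, Subgroup.mem_subgroupOf]
    have h1 := htA _ (q.out : E).2
    have h2 := htA _ (q'.out : E).2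
    rw [← hq] at h2
    simpa [mul_assoc] using A.mul_mem (A.inv_mem h1) h2
  exact Subgroup.finiteIndex_of_finite_quotient

theorem Subgroup.exists_mul_eq_of_mem_sup {G : Type*} [Group G] {A B : Subgroup G}
    (h : ∀ a ∈ A, ∀ b ∈ B, a * b = b * a) {x : G} (hx : x ∈ A ⊔ B) :
    ∃ a ∈ A, ∃ b ∈ B, a * b = x := by
  have hr := MonoidHom.noncommCoprod_range A.subtype B.subtype
    (fun a b => h a a.2 b b.2)
  rw [Subgroup.range_subtype, Subgroup.range_subtype] at hr
  rw [← hr] at hx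
  obtain ⟨⟨a, b⟩, rfl⟩ := hx
  exact ⟨a, a.2, b, b.2, rfl⟩

namespace IsHyperbolicMetric

variable {G : Type*} [Group G] {d : G → G → ℤ} {c : ℤ}

/-- Centralizers of finite sets are quasiconvex. -/
theorem exists_isQuasiconvexWith_centralizer (hd : IsHyperbolicMetric d c) {T : Set G}
    (hT : T.Finite) : ∃ κ, IsQuasiconvexWith d (Subgroup.centralizer T) κ := by
  obtain ⟨R, hR0, hR⟩ := hd.exists_bound hT
  have : Finite T := hT
  let Φ : G → T → G := fun p s => p⁻¹ * s * p
  let A : Set G := {p | ∃ x ∈ Subgroup.centralizer T, d 1 p + d p x = d 1 x}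
  -- For `x` in the centralizer, `[1, x]` and its translate by `s ∈ T` fellow travel, so the
  -- conjugates `p⁻¹ * s * p` stay in a fixed ball. If `p` and `v` have the same conjugates, then `p
  -- * v⁻¹` centralizes `T`; one `v` per value of `Φ` suffices.
  have hfin : (Φ '' A).Finite := by
    refine (Set.Finite.pi' (t := fun _ : T => {g | d 1 g ≤ 3 * R + c})
      fun _ => hd.finite_ball _).subset ?_
    rintro _ ⟨p, ⟨x, hx, hp⟩, rfl⟩ s
    have hsx : (s : G) * x = x * s := Subgroup.mem_centralizer_iff.1 hx s s.2
    have h1 : d p (s * p) ≤ 3 * R + c := by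
      refine hd.fellow_travel (x := 1) (y := x) (x' := s * 1) (y' := s * x) hp ?_ ?_ ?_ ?_
      · simpa only [hd.mul_left] using hp
      · rw [hd.mul_left]
      · rw [mul_one]; exact hR s s.2
      · rw [hsx, hd.dist_mul_right]; exact hR s s.2
    rw [hd.dist_eq, ← mul_assoc] at h1
    exact h1
  have hv : ∀ f : T → G, ∃ v, f ∈ Φ '' A → Φ v = f := by
    intro f
    by_cases hf : f ∈ Φ '' A
    · obtain ⟨v, -, hv⟩ := hf
      exact ⟨v, fun _ => hv⟩
    · exact ⟨1, fun h => absurd h hf⟩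
  choose v hv using hv
  obtain ⟨κ, -, hκ⟩ := hd.exists_bound (hfin.image v)
  refine ⟨κ, fun x hx p hp => ⟨p * (v (Φ p))⁻¹, ?_, ?_⟩⟩
  · have hpv := hv (Φ p) ⟨p, ⟨x, hx, hp⟩, rfl⟩
    rw [Subgroup.mem_centralizer_iff]
    intro s hs
    have h1 : (v (Φ p))⁻¹ * s * v (Φ p) = p⁻¹ * s * p := congrFun hpv ⟨s, hs⟩
    have h2 : s * p = p * ((v (Φ p))⁻¹ * s * v (Φ p)) := by rw [h1]; group
    rw [← mul_assoc, h2]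
    group
  · rw [hd.dist_mul_right, hd.dist_one_inv]
    exact hκ _ ⟨_, ⟨p, ⟨x, hx, hp⟩, rfl⟩, rfl⟩

/-- Quasiconvex subgroups are finitely generated. -/
theorem exists_finite_closure_eq (hd : IsHyperbolicMetric d c) {K : Subgroup G} {κ : ℤ}
    (hK : IsQuasiconvexWith d K κ) : ∃ T : Set G, T.Finite ∧ Subgroup.closure T = K := by
  have hκ : 0 ≤ κ := by
    obtain ⟨q, -, hq⟩ := hK 1 K.one_mem 1 (by simp [hd.self])
    exact (hd.nonneg _ _).trans hq
  let T : Set G := {g | d 1 g ≤ 2 * κ + 1} ∩ K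
  refine ⟨T, (hd.finite_ball _).subset Set.inter_subset_left, le_antisymm
    ((Subgroup.closure_le K).2 Set.inter_subset_right) ?_⟩
  -- Walking along a geodesic, the nearby elements of `K` for consecutive points differ by at most
  -- `κ + 1 + κ`.
  have key : ∀ n : ℕ, ∀ p x, x ∈ K → d 1 p + d p x = d 1 x → d 1 p = n → ∀ q ∈ K, d p q ≤ κ →
      q ∈ Subgroup.closure T := by
    intro n
    induction n with
    | zero =>
      intro p x _ _ hp q hq hpq
      refine Subgroup.subset_closure ⟨?_, hq⟩
      have := hd.triangle 1 p q
      push_cast at hp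
      change d 1 q ≤ 2 * κ + 1
      omega
    | succ n ih =>
      intro p x hx hpx hp q hq hpq
      push_cast at hp
      obtain ⟨p', h1, h2⟩ := hd.interpolate 1 p n (by omega) (by omega)
      have h3 : d 1 p' + d p' x = d 1 x := by
        have := hd.triangle 1 p' x
        have := hd.triangle p' p x
        omega
      obtain ⟨q', hq', hpq'⟩ := hK x hx p' h3
      have h4 := ih p' x hx h3 h1 q' hq' hpq'
      have h5 : q'⁻¹ * q ∈ T := by
        refine ⟨?_, K.mul_mem (K.inv_mem hq') hq⟩
        change d 1 (q'⁻¹ * q) ≤ 2 * κ + 1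
        rw [← hd.dist_eq]
        have := hd.triangle q' p' q
        have := hd.triangle p' p q
        have := hd.symm q' p'
        omega
      simpa using Subgroup.mul_mem _ h4 (Subgroup.subset_closure h5)
  intro x hx
  refine key (d 1 x).toNat x x hx (by simp [hd.self]) ?_ x hx (by simpa [hd.self] using hκ)
  have := hd.nonneg 1 x
  omega

/-- The centralizer `K` of `g` is finitely generated, so its centre `Z`, being the centralizer of a
finite set, is quasiconvex. As `Z` commutes with `F`, the group `M ⊔ Z` is virtually abelian and
maximality gives `Z ≤ M = ⟨g⟩ × F`. Thus `Z` contains `⟨g⟩` and lies within bounded distance of it.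
-/
theorem exists_isQuasiconvexWith_zpowers (hd : IsHyperbolicMetric d c) {g : G} {M F : Subgroup G}
    (hM : Maximal (fun K : Subgroup G => IsVirtuallyAbelian K) M) (hF : Finite F)
    (hMF : IsInternalDirectProduct M (Subgroup.zpowers g) F) :
    ∃ κ, IsQuasiconvexWith d (Subgroup.zpowers g) κ := by
  obtain ⟨κ₀, hκ₀⟩ := hd.exists_isQuasiconvexWith_centralizer (Set.finite_singleton g)
  obtain ⟨T, hT, hTK⟩ := hd.exists_finite_closure_eq hκ₀
  obtain ⟨κ, hκ⟩ := hd.exists_isQuasiconvexWith_centralizer hT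
  rw [← Subgroup.centralizer_closure, hTK] at hκ
  set K := Subgroup.centralizer ({g} : Set G) with hKdef
  set Z := Subgroup.centralizer (K : Set G) with hZdef
  have hgK : g ∈ K := by simp [hKdef, Subgroup.mem_centralizer_iff]
  have hgZ : g ∈ Z := by
    rw [hZdef, Subgroup.mem_centralizer_iff]
    intro k hk
    exact (Subgroup.mem_centralizer_iff.1 hk g rfl).symm
  have hZK : Z ≤ K := by
    intro z hz
    rw [hKdef, Subgroup.mem_centralizer_iff]
    rintro _ rfl
    exact Subgroup.mem_centralizer_iff.1 hz _ hgK
  have hFK : F ≤ K := by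
    intro f hf
    rw [hKdef, Subgroup.mem_centralizer_iff]
    rintro _ rfl
    exact hMF.commute _ (Subgroup.mem_zpowers _) f hf
  have hZF : ∀ z ∈ Z, ∀ f ∈ F, z * f = f * z := fun z hz f hf =>
    (Subgroup.mem_centralizer_iff.1 hz f (hFK hf)).symm
  have hsup : M ⊔ Z ≤ Z ⊔ F := by
    rw [← hMF.sup_eq]
    refine sup_le (sup_le ?_ le_sup_right) le_sup_left
    exact ((Subgroup.zpowers_le).2 hgZ).trans le_sup_left
  have hva : IsVirtuallyAbelian (M ⊔ Z : Subgroup G) := by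
    refine IsVirtuallyAbelian.of_cover (A := Z) (T := F)
      (fun a ha b hb => Subgroup.mem_centralizer_iff.1 hb a (hZK ha)) hF fun x hx => ?_
    obtain ⟨z, hz, f, hf, rfl⟩ := Subgroup.exists_mul_eq_of_mem_sup hZF (hsup hx)
    exact ⟨f, hf, by rw [hZF z hz f hf]; simpa using hz⟩
  have hZM : Z ≤ M := le_sup_right.trans (hM.2 hva le_sup_left)
  obtain ⟨R, hR0, hR⟩ := hd.exists_bound (B := (F : Set G)) hF
  refine ⟨κ + R, fun x hx p hp => ?_⟩
  obtain ⟨q, hq, hpq⟩ := hκ x ((Subgroup.zpowers_le).2 hgZ hx) p hp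
  have hqM := hZM hq
  rw [← hMF.sup_eq] at hqM
  obtain ⟨y, hy, f, hf, rfl⟩ := Subgroup.exists_mul_eq_of_mem_sup hMF.commute hqM
  refine ⟨y, hy, ?_⟩
  have h1 := hd.triangle p (y * f) y
  have h2 := hd.dist_mul_right y f
  have h3 := hd.symm y (y * f)
  have h4 := hR f hf
  omega

/-- If `h` does not commensurate the quasiconvex subgroup `⟨g⟩`, then `h⟨g⟩` and `⟨g⟩`
diverge. -/
theorem exists_gromovProduct_le (hd : IsHyperbolicMetric d c) {g : G} (hg : ¬ IsOfFinOrder g)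
    {κ : ℤ} (hκ : IsQuasiconvexWith d (Subgroup.zpowers g) κ) {h : G}
    (hh : h ∉ cyclicCommensurator g) :
    ∃ C, ∀ m n : ℤ, d 1 (h * g ^ m) + d 1 (g ^ n) - d (h * g ^ m) (g ^ n) ≤ C := by
  have hκ0 : 0 ≤ κ := by
    obtain ⟨q, -, hq⟩ := hκ 1 (one_mem _) 1 (by simp [hd.self])
    exact (hd.nonneg _ _).trans hq
  set r := d 1 h with hr
  have hr0 : 0 ≤ r := hd.nonneg _ _
  set B := {x | d 1 x ≤ 2 * κ + 2 * c + (3 * r + c)} with hB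
  have hBfin : B.Finite := hd.finite_ball _
  set N := hBfin.toFinset.card with hN
  refine ⟨2 * ((2 * κ + 1) * N + r), fun m n => ?_⟩
  by_contra! hmn
  -- If the Gromov product is large, `[1, g ^ n]` and `h[1, g ^ m]` fellow travel long enough for `N
  -- + 1` sample points, one more than `B` has elements. Two samples then share the same `g ^ (-i) *
  -- h * g ^ j`. The spacing `2κ + 1` forces their exponents `i` to differ.
  have key : ∀ k : Fin (N + 1), ∃ p, ∃ i j : ℤ, d 1 p = (2 * κ + 1) * (k : ℕ) ∧
      d p (g ^ i) ≤ κ ∧ g ^ (-i) * h * g ^ j ∈ B := by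
    intro k
    have ht0 : 0 ≤ (2 * κ + 1) * ((k : ℕ) : ℤ) := by positivity
    have ht1 : (2 * κ + 1) * ((k : ℕ) : ℤ) ≤ (2 * κ + 1) * N := by
      have : ((k : ℕ) : ℤ) ≤ N := by have := k.2; omega
      gcongr
    generalize (2 * κ + 1) * ((k : ℕ) : ℤ) = t at *
    generalize (2 * κ + 1) * (N : ℤ) = R at *
    have e1 := hd.triangle 1 (g ^ n) (h * g ^ m)
    have e2 := hd.triangle 1 (h * g ^ m) (g ^ n)
    have e3 := hd.symm (g ^ n) (h * g ^ m)
    have e4 := hd.triangle 1 h (h * g ^ m)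
    have e5 := hd.dist_mul_right h (g ^ m)
    obtain ⟨p, hp, hp'⟩ := hd.interpolate 1 (g ^ n) t ht0 (by omega)
    obtain ⟨q, hq, hq'⟩ := hd.interpolate 1 (h * g ^ m) t ht0 (by omega)
    obtain ⟨x, hx, hx'⟩ := hd.interpolate 1 (g ^ m) t ht0 (by omega)
    have hpq : d p q ≤ 2 * c := by
      have := hd.const_nonneg
      have := hd.four_point 1 p (g ^ n) (h * g ^ m)
      have := hd.four_point 1 p (h * g ^ m) q
      have := hd.symm (h * g ^ m) q
      have := hd.nonneg p q
      omega
    have hqx : d q (h * x) ≤ 3 * r + c := by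
      refine hd.fellow_travel (x := 1) (y := h * g ^ m) (x' := h * 1) (y' := h * g ^ m)
        (by omega) ?_ ?_ ?_ ?_
      · simp only [hd.mul_left]; omega
      · rw [hd.mul_left, hq, hx]
      · rw [mul_one]
      · rw [hd.self]; exact hr0
    obtain ⟨_, ⟨i, rfl⟩, hi⟩ := hκ _ ⟨n, rfl⟩ p (show d 1 p + d p (g ^ n) = d 1 (g ^ n) by omega)
    obtain ⟨_, ⟨j, rfl⟩, hj⟩ := hκ _ ⟨m, rfl⟩ x (show d 1 x + d x (g ^ m) = d 1 (g ^ m) by omega)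
    refine ⟨p, i, j, hp, hi, ?_⟩
    change d 1 _ ≤ _
    have h1 : g ^ (-i) * h * g ^ j = (g ^ i)⁻¹ * (h * g ^ j) := by rw [zpow_neg, mul_assoc]
    rw [h1, ← hd.dist_eq]
    dsimp only at hi hj
    have := hd.triangle (g ^ i) p (h * g ^ j)
    have := hd.triangle p q (h * g ^ j)
    have := hd.triangle q (h * x) (h * g ^ j)
    have := hd.mul_left h x (g ^ j)
    have := hd.symm p (g ^ i)
    omega
  choose p i j hp hi hB' using key
  obtain ⟨k, -, l, -, hkl, heq⟩ := Finset.exists_ne_map_eq_of_card_lt_of_maps_to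
    (s := Finset.univ) (t := hBfin.toFinset) (by simp [hN])
    (f := fun k => g ^ (-i k) * h * g ^ j k) (by intro k _; simpa using hB' k)
  have hik : i k ≠ i l := by
    intro hil
    have h1 := hi k
    have h2 := hi l
    rw [hil] at h1
    have h3 := hd.triangle 1 (p k) (p l)
    have h4 := hd.triangle 1 (p l) (p k)
    have h5 := hd.triangle (p k) (g ^ i l) (p l)
    have h6 := hd.symm (g ^ i l) (p l)
    have h7 := hd.symm (p k) (p l)
    rw [hp, hp] at h3 h4
    have h8 : ((k : ℕ) : ℤ) < (l : ℕ) ∨ ((l : ℕ) : ℤ) < (k : ℕ) := by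
      have := Fin.val_ne_of_ne hkl
      omega
    rcases h8 with h8 | h8 <;> nlinarith
  apply hh
  have h1 : h * g ^ (j k - j l) = g ^ (i k - i l) * h := by
    have h2 : g ^ i k * (g ^ (-i k) * h * g ^ j k) * g ^ (-j l) =
      g ^ i k * (g ^ (-i l) * h * g ^ j l) * g ^ (-j l) := by
      rw [show g ^ (-i k) * h * g ^ j k = g ^ (-i l) * h * g ^ j l from heq]
    calc h * g ^ (j k - j l) = g ^ i k * (g ^ (-i k) * h * g ^ j k) * g ^ (-j l) := by group
      _ = _ := h2
      _ = _ := by group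
  refine ⟨_, _, ?_, sub_ne_zero.2 hik, h1⟩
  intro h0
  rw [h0, zpow_zero, mul_one, eq_comm, mul_eq_right] at h1
  exact sub_ne_zero.2 hik (injective_zpow_iff_not_isOfFinOrder.2 hg (by simpa using h1))

/-- The commensurator of a quasiconvex infinite cyclic subgroup is virtually abelian. -/
theorem isVirtuallyAbelian_cyclicCommensurator (hd : IsHyperbolicMetric d c) {g : G}
    (hg : ¬ IsOfFinOrder g) {κ : ℤ} (hκ : IsQuasiconvexWith d (Subgroup.zpowers g) κ) :
    IsVirtuallyAbelian (cyclicCommensurator g) := by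
  have hgE : ∀ i : ℤ, g ^ i ∈ cyclicCommensurator g := fun i =>
    ⟨1, 1, one_ne_zero, one_ne_zero, by simp [← zpow_add_one, ← zpow_one_add, add_comm]⟩
  -- Every double coset `⟨g⟩h⟨g⟩` in the commensurator meets a ball independent of `h`: the
  -- quadrilateral `1, h, g ^ (b * k) * h, g ^ (b * k)` has two long sides, and a point of one far
  -- from both ends is close to the other.
  have key : ∀ h ∈ cyclicCommensurator g, ∃ i j : ℤ,
      d 1 (g ^ (-i) * h * g ^ j) ≤ 2 * κ + 2 * c + 1 := by
    rintro h ⟨a, b, ha, hb, hab⟩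
    have hr0 : 0 ≤ d 1 h := hd.nonneg _ _
    have hc0 := hd.const_nonneg
    obtain ⟨k, hk⟩ := hd.exists_zpow_gt hg hb (2 * (d 1 h + 3 * c + 1))
    have hab' : h * g ^ (a * k) = g ^ (b * k) * h := by
      have h1 : SemiconjBy h (g ^ a) (g ^ b) := hab
      have h2 := h1.zpow_right k
      rwa [← zpow_mul, ← zpow_mul] at h2
    obtain ⟨p, hp, hp'⟩ := hd.interpolate 1 (g ^ (b * k)) (d 1 h + 3 * c + 1) (by omega) (by omega)
    obtain ⟨q, hq, hpq⟩ := hd.exists_near p h (h * g ^ (a * k))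
    have hq' : d 1 (h⁻¹ * q) + d (h⁻¹ * q) (g ^ (a * k)) = d 1 (g ^ (a * k)) := by
      have h1 := hd.mul_left h⁻¹ h q
      have h2 := hd.mul_left h⁻¹ q (h * g ^ (a * k))
      have h3 := hd.dist_mul_right h (g ^ (a * k))
      rw [inv_mul_cancel] at h1
      rw [inv_mul_cancel_left] at h2
      omega
    obtain ⟨_, ⟨i, rfl⟩, hi⟩ := hκ _ ⟨b * k, rfl⟩ p
      (show d 1 p + d p (g ^ (b * k)) = d 1 (g ^ (b * k)) by omega)
    obtain ⟨_, ⟨j, rfl⟩, hj⟩ := hκ _ ⟨a * k, rfl⟩ (h⁻¹ * q) hq'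
    refine ⟨i, j, ?_⟩
    have h1 : g ^ (-i) * h * g ^ j = (g ^ i)⁻¹ * (h * g ^ j) := by rw [zpow_neg, mul_assoc]
    rw [h1, ← hd.dist_eq]
    dsimp only at hi hj
    have hprod : d p h + d p (h * g ^ (a * k)) - d h (h * g ^ (a * k)) ≤ 2 * c := by
      rw [hab']
      have := hd.four_point p 1 h (g ^ (b * k))
      have := hd.four_point p h (g ^ (b * k) * h) (g ^ (b * k))
      have := hd.dist_mul_right (g ^ (b * k)) h
      have := hd.symm (g ^ (b * k) * h) (g ^ (b * k))
      have := hd.symm 1 p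
      have := hd.triangle 1 h p
      have := hd.symm h p
      have := hd.triangle p (g ^ (b * k) * h) (g ^ (b * k))
      omega
    have e1 := hd.mul_left h (h⁻¹ * q) (g ^ j)
    rw [mul_inv_cancel_left] at e1
    have := hd.triangle (g ^ i) p (h * g ^ j)
    have := hd.triangle p q (h * g ^ j)
    have := hd.symm p (g ^ i)
    omega
  set B := {x | d 1 x ≤ 2 * κ + 2 * c + 1} ∩ cyclicCommensurator g with hBdef
  have hB : B.Finite := (hd.finite_ball _).subset Set.inter_subset_left
  have hE : ∀ h : G, ∃ a b : ℤ, b ≠ 0 ∧ (h ∈ B → h * g ^ a = g ^ b * h) := by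
    intro h
    by_cases hh : h ∈ B
    · obtain ⟨a, b, -, hb, hab⟩ := hh.2
      exact ⟨a, b, hb, fun _ => hab⟩
    · exact ⟨0, 1, one_ne_zero, fun h' => absurd h' hh⟩
  choose α β hβ hαβ using hE
  -- In `x = g ^ i * b * g ^ (-j)`, multiples of `β b` in the exponent `i` can be moved across `b`,
  -- so only finitely many residues of `i` are needed for each `b`.
  refine IsVirtuallyAbelian.of_cover (A := Subgroup.zpowers g)
    (T := ⋃ b ∈ B, (fun ρ : ℤ => g ^ ρ * b) '' Set.Ico 0 |β b|) ?_
    (hB.biUnion fun b _ => (Set.finite_Ico _ _).image _) ?_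
  · rintro _ ⟨a, rfl⟩ _ ⟨b, rfl⟩
    exact zpow_mul_comm g a b
  · intro x hx
    obtain ⟨i, j, hij⟩ := key x hx
    set b := g ^ (-i) * x * g ^ j with hb
    have hbB : b ∈ B := ⟨hij, mul_mem (mul_mem (hgE _) hx) (hgE _)⟩
    refine ⟨g ^ (i % β b) * b, ?_, ?_⟩
    · refine Set.mem_biUnion hbB ⟨_, ⟨Int.emod_nonneg _ (hβ b), Int.emod_lt_abs _ (hβ b)⟩, rfl⟩
    · refine ⟨α b * (i / β b) - j, ?_⟩
      have h1 : SemiconjBy b (g ^ α b) (g ^ β b) := hαβ b hbB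
      have h2 : b * g ^ (α b * (i / β b)) = g ^ (β b * (i / β b)) * b := by
        have h2 := h1.zpow_right (i / β b)
        rwa [← zpow_mul, ← zpow_mul] at h2
      have hx' : x = g ^ i * b * g ^ (-j) := by rw [hb]; group
      dsimp only
      rw [eq_inv_mul_iff_mul_eq, sub_eq_add_neg, zpow_add, ← mul_assoc, mul_assoc (g ^ (i % β b)),
        h2, ← mul_assoc, ← zpow_add, Int.emod_add_mul_ediv, ← hx']

theorem cyclicCommensurator_eq (hd : IsHyperbolicMetric d c) {g : G} {M F : Subgroup G}
    (hg : ¬ IsOfFinOrder g) (hM : Maximal (fun K : Subgroup G => IsVirtuallyAbelian K) M)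
    (hF : Finite F) (hMF : IsInternalDirectProduct M (Subgroup.zpowers g) F) :
    cyclicCommensurator g = M := by
  obtain ⟨κ, hκ⟩ := hd.exists_isQuasiconvexWith_zpowers hM hF hMF
  have hle : M ≤ cyclicCommensurator g := by
    rw [← hMF.sup_eq]
    refine sup_le ?_ fun f hf => ?_
    · rintro _ ⟨i, rfl⟩
      exact ⟨1, 1, one_ne_zero, one_ne_zero, by simp [← zpow_add_one, ← zpow_one_add, add_comm]⟩
    · refine ⟨1, 1, one_ne_zero, one_ne_zero, ?_⟩
      rw [zpow_one]
      exact (hMF.commute g (Subgroup.mem_zpowers g) f hf).symm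
  exact le_antisymm (hM.2 (hd.isVirtuallyAbelian_cyclicCommensurator hg hκ) hle) hle

end IsHyperbolicMetric

/-- Raising the conjugation relation for `g` to the power `a` turns it into one for `h`. Used in
both directions, this identifies the commensurators of elements with a common power. -/
theorem cyclicCommensurator_le_of_zpow_eq {G : Type*} [Group G] {g h : G} {a b : ℤ}
    (hb : b ≠ 0) (hab : g ^ a = h ^ b) : cyclicCommensurator g ≤ cyclicCommensurator h := by
  rintro x ⟨m, n, hm, hn, hmn⟩
  refine ⟨b * m, b * n, mul_ne_zero hb hm, mul_ne_zero hb hn, ?_⟩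
  have h1 : SemiconjBy x (g ^ m) (g ^ n) := hmn
  have h2 := h1.zpow_right a
  rw [← zpow_mul, ← zpow_mul, mul_comm m, mul_comm n, zpow_mul, zpow_mul, hab, ← zpow_mul,
    ← zpow_mul] at h2
  exact h2

/-- The exponent `Nat.card F` kills the `F`-component of `x`, while the `⟨g⟩`-component is
nontrivial because `x ∉ F`. -/
theorem Subgroup.zpow_eq_of_isInternalDirectProduct {G : Type*} [Group G] {M F : Subgroup G}
    {g x : G} (hF : Finite F) (h : IsInternalDirectProduct M (Subgroup.zpowers g) F)
    (hx : x ∈ M) (hxF : x ∉ F) : ∃ a : ℤ, a ≠ 0 ∧ x ^ Nat.card F = g ^ a := by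
  rw [← h.sup_eq] at hx
  obtain ⟨_, ⟨a, rfl⟩, f, hf, rfl⟩ := Subgroup.exists_mul_eq_of_mem_sup h.commute hx
  refine ⟨a * Nat.card F, mul_ne_zero ?_ (by exact_mod_cast Nat.card_pos.ne'), ?_⟩
  · rintro rfl
    simp [hf] at hxF
  · have hc : Commute (g ^ a) f := h.commute _ ⟨a, rfl⟩ f hf
    have hf1 : f ^ Nat.card F = 1 :=
      congrArg Subtype.val (pow_card_eq_one' (x := (⟨f, hf⟩ : F)))
    dsimp only
    rw [hc.mul_pow, hf1, mul_one, ← zpow_natCast, ← zpow_mul]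

/-! ### Consequences of torsion-saturation -/

namespace IsTorsionSaturated

variable {G : Type*} [Group G]

theorem exists_conj_eq (h : IsTorsionSaturated G) {F : Type*} [Group F] [Finite F]
    {p q : F →* G} (hp : Function.Injective p) (hq : Function.Injective q) :
    ∃ g : G, ∀ x, g * p x * g⁻¹ = q x := by
  obtain ⟨g, hg⟩ := h.conj p.range q.range (Set.finite_range p) (Set.finite_range q)
    ((MonoidHom.ofInjective hp).symm.trans (MonoidHom.ofInjective hq))
  refine ⟨g, fun x => ?_⟩
  have h1 := hg (MonoidHom.ofInjective hp x)
  simpa only [MulEquiv.trans_apply, MulEquiv.symm_apply_apply, MonoidHom.ofInjective_apply]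
    using h1

/-- The centralizer of a finite subgroup is not covered by a finite set. -/
theorem exists_mul_notMem (h : IsTorsionSaturated G) (F : Subgroup G) [hF : Finite F] (g : G)
    {V : Set G} (hV : V.Finite) : ∃ z, (∀ f ∈ F, z * f = f * z) ∧ g * z ∉ V := by
  obtain ⟨E, hE, M, hM, -⟩ := h.exists_infinite F hF
  obtain ⟨k, hk⟩ := hE.nonempty
  obtain ⟨hk1, -, hk2⟩ := hM k hk
  by_contra! hcon
  refine Set.infinite_univ (α := ℤ) (Set.Finite.of_finite_image (f := fun i => g * k ^ i)
    (hV.subset ?_) ?_)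
  · rintro _ ⟨i, -, rfl⟩
    exact hcon _ fun f hf => hk2.commute _ ⟨i, rfl⟩ f hf
  · intro i _ j _ hij
    exact injective_zpow_iff_not_isOfFinOrder.2 hk1 (mul_left_cancel hij)

/-- If `x ∉ F` lay in both `M g` and `M k`, then `x ^ Nat.card F` would be a power of each with
nonzero exponent. The commensurators `M g` and `M k` would coincide, forcing `g = k`. So each `x ∈
U` spoils at most one `g ∈ E`. -/
theorem exists_notMem_cyclicCommensurator (h : IsTorsionSaturated G) {d : G → G → ℤ} {c : ℤ}
    (hd : IsHyperbolicMetric d c) (F : Subgroup G) [hF : Finite F] {U : Set G} (hU : U.Finite)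
    (hUF : ∀ x ∈ U, x ∉ F) : ∃ (g : G) (κ : ℤ), ¬ IsOfFinOrder g ∧ (∀ f ∈ F, g * f = f * g) ∧
      IsQuasiconvexWith d (Subgroup.zpowers g) κ ∧ ∀ x ∈ U, x ∉ cyclicCommensurator g := by
  obtain ⟨E, hE, M, hM, hinj⟩ := h.exists_infinite F hF
  have hcomm : ∀ g ∈ E, cyclicCommensurator g = M g := fun g hg =>
    hd.cyclicCommensurator_eq (hM g hg).1 (hM g hg).2.1.maximal hF (hM g hg).2.2
  have hsub : ∀ x ∈ U, {g ∈ E | x ∈ M g}.Subsingleton := by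
    rintro x hx g ⟨hg, hxg⟩ k ⟨hk, hxk⟩
    by_contra hne
    refine hinj g hg k hk hne ?_
    obtain ⟨a, ha, hxa⟩ :=
      Subgroup.zpow_eq_of_isInternalDirectProduct hF (hM g hg).2.2 hxg (hUF x hx)
    obtain ⟨b, hb, hxb⟩ :=
      Subgroup.zpow_eq_of_isInternalDirectProduct hF (hM k hk).2.2 hxk (hUF x hx)
    rw [← hcomm g hg, ← hcomm k hk]
    exact le_antisymm (cyclicCommensurator_le_of_zpow_eq hb (hxa.symm.trans hxb))
      (cyclicCommensurator_le_of_zpow_eq ha (hxb.symm.trans hxa))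
  have hfin : (⋃ x ∈ U, {g ∈ E | x ∈ M g}).Finite :=
    hU.biUnion fun x hx => (hsub x hx).finite
  obtain ⟨g, hg, hgU⟩ := (hE.sdiff hfin).nonempty
  obtain ⟨κ, hκ⟩ := hd.exists_isQuasiconvexWith_zpowers (hM g hg).2.1.maximal hF (hM g hg).2.2
  refine ⟨g, κ, (hM g hg).1, (hM g hg).2.2.commute g (Subgroup.mem_zpowers g), hκ,
    fun x hx hxg => hgU ?_⟩
  rw [hcomm g hg] at hxg
  exact Set.mem_biUnion hx ⟨hg, hxg⟩

end IsTorsionSaturated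

/-! ### Broken geodesics and separation from finite sets -/

/-- Long words in large powers of an element form broken geodesics with small Gromov products,
hence are far from `1`. -/
theorem IsHyperbolicMetric.lt_dist_one_prod {G : Type*} [Group G] {d : G → G → ℤ} {c : ℤ}
    (hd : IsHyperbolicMetric d c) {U : Set G} {s : G} {C r : ℤ}
    (hr : ∀ u ∈ U, d 1 u ≤ r)
    (hC : ∀ u ∈ U, ∀ ε ε' : ℤˣ, d 1 (u⁻¹ * s ^ (ε : ℤ)) + d 1 (s ^ (ε' : ℤ)) -
      d (u⁻¹ * s ^ (ε : ℤ)) (s ^ (ε' : ℤ)) ≤ C)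
    (h0 : 0 ≤ C) (h1 : 0 ≤ r) (hs : C + c + r < d 1 s) (l : List (ℤˣ × G))
    (hl : ∀ x ∈ l, x.2 ∈ U) (ε : ℤˣ) :
    d 1 s ≤ d 1 (s ^ (ε : ℤ) * (l.map fun x => x.2 * s ^ (x.1 : ℤ)).prod) ∧
    d 1 s + d (s ^ (ε : ℤ)) (s ^ (ε : ℤ) * (l.map fun x => x.2 * s ^ (x.1 : ℤ)).prod) -
      d 1 (s ^ (ε : ℤ) * (l.map fun x => x.2 * s ^ (x.1 : ℤ)).prod) ≤ C + c + 2 * r := by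
  have hc := hd.const_nonneg
  have hsε : ∀ ε : ℤˣ, d 1 (s ^ (ε : ℤ)) = d 1 s := by
    intro ε
    rcases Int.units_eq_one_or ε with rfl | rfl <;> simp [hd.dist_one_inv]
  induction l generalizing ε with
  | nil =>
    simp only [List.map_nil, List.prod_nil, mul_one, hsε, hd.self]
    omega
  | cons x l ih =>
    obtain ⟨ε', u⟩ := x
    have hu : u ∈ U := hl _ List.mem_cons_self
    obtain ⟨i1, i2⟩ := ih (fun x hx => hl x (List.mem_cons_of_mem _ hx)) ε'
    rw [List.map_cons, List.prod_cons]
    dsimp only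
    rw [mul_assoc u, ← mul_assoc (s ^ (ε : ℤ))]
    set W := s ^ (ε' : ℤ) * (l.map fun x => x.2 * s ^ (x.1 : ℤ)).prod
    have e1 := hd.dist_mul_right (s ^ (ε : ℤ)) u
    have e2 := hd.dist_mul_right (s ^ (ε : ℤ) * u) W
    have e3 := hd.dist_mul_right (s ^ (ε : ℤ) * u) (s ^ (ε' : ℤ))
    have e4 := hd.mul_left (s ^ (ε : ℤ) * u) W (s ^ (ε' : ℤ))
    have e5 := hC u hu (-ε) ε'
    have hinv : u⁻¹ * s ^ ((-ε : ℤˣ) : ℤ) = (s ^ (ε : ℤ) * u)⁻¹ := by simp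
    rw [hinv, hd.dist_one_inv] at e5
    have e6 := hd.mul_left (s ^ (ε : ℤ) * u) (s ^ (ε : ℤ) * u)⁻¹ (s ^ (ε' : ℤ))
    rw [mul_inv_cancel] at e6
    -- The second alternative, with `e5` and `i2`, would give `2 * d 1 s ≤ 2 * (C + c + r)`, against
    -- `hs`. The first says that prefixing `s ^ ε * u` adds its length up to `C + c`, which yields
    -- both conclusions.
    have e7 := hd.four_point (s ^ (ε : ℤ) * u) 1 (s ^ (ε : ℤ) * u * W)
      (s ^ (ε : ℤ) * u * s ^ (ε' : ℤ))
    have e8 := hd.symm (s ^ (ε : ℤ) * u) 1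
    have e9 := hd.symm W (s ^ (ε' : ℤ))
    have e10 := hd.triangle 1 (s ^ (ε : ℤ) * u) (s ^ (ε : ℤ))
    have e11 := hd.triangle (s ^ (ε : ℤ)) (s ^ (ε : ℤ) * u) (s ^ (ε : ℤ) * u * W)
    have e12 := hd.symm (s ^ (ε : ℤ) * u) (s ^ (ε : ℤ))
    have e13 := hr u hu
    have e14 := hsε ε
    have e15 := hsε ε'
    omega

theorem IsTorsionSaturated.exists_separating {G : Type*} [Group G] (h : IsTorsionSaturated G)
    (hG : IsHyperbolicGroup G) (F : Subgroup G) [Finite F] {U K : Set G} (hU : U.Finite)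
    (hUF : ∀ x ∈ U, x ∉ F) (hK : K.Finite) : ∃ s : G, (∀ f ∈ F, s * f = f * s) ∧
      ∀ l : List (ℤˣ × G), (∀ x ∈ l, x.2 ∈ U) → ∀ ε : ℤˣ,
        s ^ (ε : ℤ) * (l.map fun x => x.2 * s ^ (x.1 : ℤ)).prod ∉ K := by
  obtain ⟨d, c, hd⟩ := hG.exists_isHyperbolicMetric
  obtain ⟨g, κ, hg, hgF, hκ, hgU⟩ := h.exists_notMem_cyclicCommensurator hd F hU hUF
  have hex : ∀ u : G, ∃ C, u ∈ U →
      ∀ m n : ℤ, d 1 (u⁻¹ * g ^ m) + d 1 (g ^ n) - d (u⁻¹ * g ^ m) (g ^ n) ≤ C := by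
    intro u
    by_cases hu : u ∈ U
    · obtain ⟨C, hC⟩ := hd.exists_gromovProduct_le hg hκ (h := u⁻¹)
        (fun hmem => hgU u hu (inv_mem_iff.1 hmem))
      exact ⟨C, fun _ => hC⟩
    · exact ⟨0, fun hu' => absurd hu' hu⟩
  choose C hC using hex
  obtain ⟨C₀, hC₀⟩ := (hU.image C).bddAbove
  obtain ⟨r, hr0, hr⟩ := hd.exists_bound hU
  obtain ⟨R, -, hR⟩ := hd.exists_bound hK
  -- The first bound is the length hypothesis of `lt_dist_one_prod`; the second puts the products
  -- outside a ball containing `K`.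
  obtain ⟨N, hN⟩ := hd.exists_zpow_gt hg one_ne_zero (max (max C₀ 0 + c + r) R)
  rw [one_mul] at hN
  refine ⟨g ^ N, fun f hf => (Commute.zpow_left (hgF f hf) N), fun l hl ε hmem => ?_⟩
  have key := (hd.lt_dist_one_prod (s := g ^ N) hr (C := max C₀ 0) ?_ (le_max_right _ _) hr0
    ((le_max_left _ _).trans_lt hN) l hl ε).1
  · have := hR _ hmem
    have := (le_max_right _ _).trans_lt hN
    omega
  · intro u hu ε ε'
    have h1 : C u ≤ C₀ := hC₀ ⟨u, hu, rfl⟩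
    rw [← zpow_mul, ← zpow_mul]
    exact ((hC u hu _ _).trans h1).trans (le_max_left _ _)

/-! ### Finite generation, reduced words and the two constructions -/

theorem IsFullyResidually.of_forall_ne_one {G L : Type*} [Group G] [Group L]
    (h : ∀ Y : Set L, Y.Finite → 1 ∉ Y → ∃ f : L →* G, ∀ y ∈ Y, f y ≠ 1) :
    IsFullyResidually G L := by
  intro X hX
  obtain ⟨f, hf⟩ := h (Set.image2 (fun x y => x⁻¹ * y) X X \ {1})
    ((hX.image2 _ hX).sdiff) (by simp)
  refine ⟨f, fun x hx y hy hxy => ?_⟩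
  by_contra hne
  refine hf (x⁻¹ * y) ⟨⟨x, hx, y, hy, rfl⟩, ?_⟩ (by simp [hxy])
  simpa [inv_mul_eq_one] using hne

theorem inv_mul_inv_eq_of_mul_mul_eq_one {G : Type*} [Group G] {x y z : G} (h : x * y * z = 1) :
    x⁻¹ * z⁻¹ = y := by
  rw [inv_mul_eq_iff_eq_mul, inv_eq_iff_mul_eq_one, mul_eq_one_comm]
  exact h

theorem HNNExtension.fg {H : Type*} [Group H] {A B : Subgroup H} {φ : A ≃* B}
    (hH : Group.FG H) : Group.FG (HNNExtension H A B φ) := by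
  obtain ⟨S, hS, hfin⟩ := Group.fg_iff.1 hH
  refine Group.fg_iff.2 ⟨HNNExtension.of '' S ∪ {HNNExtension.t}, ?_,
    (hfin.image _).union (Set.finite_singleton _)⟩
  rw [eq_top_iff]
  rintro x -
  induction x using HNNExtension.induction_on with
  | of g =>
    have hg : HNNExtension.of g ∈
        (Subgroup.closure S).map (HNNExtension.of : H →* HNNExtension H A B φ) :=
      ⟨g, hS ▸ Subgroup.mem_top g, rfl⟩
    rw [MonoidHom.map_closure] at hg
    exact Subgroup.closure_mono Set.subset_union_left hg
  | t => exact Subgroup.subset_closure (Or.inr rfl)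
  | mul x y hx hy => exact mul_mem hx hy
  | inv x hx => exact inv_mem hx

theorem HNNExtension.exists_reducedWord {H : Type*} [Group H] {A B : Subgroup H} (φ : A ≃* B)
    (x : HNNExtension H A B φ) :
    ∃ w : HNNExtension.NormalWord.ReducedWord H A B, w.prod φ = x := by
  classical
  obtain ⟨d⟩ := HNNExtension.NormalWord.TransversalPair.nonempty H A B
  exact ⟨(HNNExtension.NormalWord.equiv φ d x).toReducedWord,
    (HNNExtension.NormalWord.equiv φ d).symm_apply_apply x⟩

theorem Monoid.PushoutI.fg {ι : Type*} [Finite ι] {X : ι → Type*} [∀ i, Group (X i)]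
    {F : Type*} [Group F] [Finite F] {m : ∀ i, F →* X i} (hX : ∀ i, Group.FG (X i)) :
    Group.FG (Monoid.PushoutI m) := by
  choose S hS hfin using fun i => Group.fg_iff.1 (hX i)
  refine Group.fg_iff.2 ⟨(⋃ i, Monoid.PushoutI.of (φ := m) i '' S i) ∪
    Set.range (Monoid.PushoutI.base m), ?_,
    (Set.finite_iUnion fun i => (hfin i).image _).union (Set.finite_range _)⟩
  rw [eq_top_iff]
  rintro x -
  induction x using Monoid.PushoutI.induction_on with
  | of i g =>
    have hg : Monoid.PushoutI.of (φ := m) i g ∈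
        (Subgroup.closure (S i)).map (Monoid.PushoutI.of (φ := m) i) :=
      ⟨g, hS i ▸ Subgroup.mem_top g, rfl⟩
    rw [MonoidHom.map_closure] at hg
    exact Subgroup.closure_mono ((Set.subset_iUnion (fun i => Monoid.PushoutI.of (φ := m) i '' S i)
      i).trans Set.subset_union_left) hg
  | base h => exact Subgroup.subset_closure (Or.inr ⟨h, rfl⟩)
  | mul x y hx hy => exact mul_mem hx hy

theorem Monoid.PushoutI.exists_reduced {ι : Type*} {X : ι → Type*} [∀ i, Group (X i)]
    {F : Type*} [Group F] {m : ∀ i, F →* X i} (hm : ∀ i, Function.Injective (m i))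
    (x : Monoid.PushoutI m) : ∃ (a : F) (w : Monoid.CoprodI.Word X), Monoid.PushoutI.Reduced m w ∧
      Monoid.PushoutI.base m a * Monoid.PushoutI.ofCoprodI w.prod = x := by
  classical
  obtain ⟨d⟩ := Monoid.PushoutI.NormalWord.transversal_nonempty m hm
  set w := Monoid.PushoutI.NormalWord.equiv (d := d) x with hw
  refine ⟨w.head, w.toWord, ?_, (Monoid.PushoutI.NormalWord.equiv (d := d)).symm_apply_apply x⟩
  rintro ⟨i, g⟩ hg hrange
  have h1 := w.normalized i g hg
  -- A letter in both the image of `F` and the transversal would factor in two ways, unless it is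
  -- `1`.
  have h2 := (d.compl i).1 (a₁ := (⟨g, hrange⟩, ⟨1, d.one_mem i⟩))
    (a₂ := (⟨1, one_mem _⟩, ⟨g, h1⟩)) (by simp)
  have h3 : g = 1 := congrArg (fun y => (y.1 : X i)) h2
  exact w.ne_one _ hg h3

theorem HNNExtension.isFullyResidually {G H : Type*} [Group G] [Group H]
    (hG : IsHyperbolicGroup G) (hsat : IsTorsionSaturated G) {F₁ F₂ : Subgroup H} (α : F₁ ≃* F₂)
    (hF₁ : Finite F₁) (hH : IsFullyResidually G H) :
    IsFullyResidually G (HNNExtension H F₁ F₂ α) := by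
  have hF₂ : Finite F₂ := Finite.of_equiv _ α.toEquiv
  refine IsFullyResidually.of_forall_ne_one fun Y hY h1Y => ?_
  choose w hw using HNNExtension.exists_reducedWord α
  -- the letters of the reduced words of the elements of `Y`
  let A : Set H := ⋃ y ∈ Y, {h | h = (w y).head ∨ h ∈ (w y).toList.map Prod.snd}
  have hA : A.Finite := hY.biUnion fun y _ =>
    (Set.finite_singleton _).union (List.finite_toSet _)
  obtain ⟨φ, hφ⟩ := hH (A ∪ (F₁ ∪ F₂))
    (hA.union ((Set.toFinite (F₁ : Set H)).union (Set.toFinite (F₂ : Set H))))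
  let p : F₁ →* G := φ.comp F₁.subtype
  let q : F₁ →* G := (φ.comp F₂.subtype).comp α.toMonoidHom
  have hp : Function.Injective p := fun x y hxy =>
    Subtype.ext (hφ (Or.inr (Or.inl x.2)) (Or.inr (Or.inl y.2)) hxy)
  have hq : Function.Injective q := fun x y hxy =>
    α.injective (Subtype.ext (hφ (Or.inr (Or.inr (α x).2)) (Or.inr (Or.inr (α y).2)) hxy))
  obtain ⟨g₀, hg₀⟩ := hsat.exists_conj_eq hp hq
  let F : Subgroup G := p.range
  have hF : Finite F := Set.finite_range p
  -- Correcting `g₀` by `z` keeps the conjugation property and ensures `φ h * τ ∉ F` and `τ⁻¹ * φ h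
  -- ∉ F` for all letters `h`. This covers consecutive stable letters of equal sign, about which
  -- reducedness says nothing.
  obtain ⟨z, hzF, hzV⟩ := hsat.exists_mul_notMem F g₀
    (V := Set.image2 (fun h f => (φ h)⁻¹ * f) A F ∪ Set.image2 (fun h f => φ h * f) A F)
    ((hA.image2 _ hF).union (hA.image2 _ hF))
  set τ := g₀ * z with hτ
  have hτp : ∀ x, τ * p x * τ⁻¹ = q x := by
    intro x
    rw [← hg₀ x, hτ, mul_inv_rev, mul_assoc g₀, hzF _ ⟨x, rfl⟩]
    group
  -- The stable letter goes to `τ * s`, and `a ε`, `b ε` are the parts of `(τ * s) ^ ε` to the left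
  -- and right of `s ^ ε`. Between two powers of `s` there remains `b ε * φ h * a ε'`.
  let a : ℤˣ → G := fun ε => if ε = 1 then τ else 1
  let b : ℤˣ → G := fun ε => if ε = 1 then 1 else τ⁻¹
  let U : Set G := {u | u ∉ F ∧ ∃ h ∈ A, ∃ ε ε', u = b ε * φ h * a ε'}
  have hU : U.Finite := by
    refine (hA.biUnion fun h _ => Set.finite_iUnion fun ε : ℤˣ => Set.finite_iUnion
      fun ε' : ℤˣ => Set.finite_singleton (b ε * φ h * a ε')).subset ?_
    rintro u ⟨-, h, hh, ε, ε', rfl⟩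
    exact Set.mem_biUnion hh (Set.mem_iUnion.2 ⟨ε, Set.mem_iUnion.2 ⟨ε', rfl⟩⟩)
  let K₁ : Set G := Set.image2 (fun h ε => (φ h * a ε)⁻¹) A Set.univ
  let K₂ : Set G := Set.image2 (fun h ε => (b ε * φ h)⁻¹) A Set.univ
  obtain ⟨s, hsF, hs⟩ := hsat.exists_separating hG F (K := Set.image2 (· * ·) K₁ K₂) hU
    (fun u hu => hu.1) ((hA.image2 _ Set.finite_univ).image2 _ (hA.image2 _ Set.finite_univ))
  have hlift : ∀ x : F₁, (τ * s) * φ x = φ (α x) * (τ * s) := by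
    intro x
    have h1 : s * φ x = φ x * s := hsF _ ⟨x, rfl⟩
    have h2 : τ * φ x * τ⁻¹ = φ (α x) := hτp x
    rw [mul_assoc, h1, ← h2]
    group
  have hpow : ∀ ε : ℤˣ, (τ * s) ^ (ε : ℤ) = a ε * s ^ (ε : ℤ) * b ε := by
    intro ε
    rcases Int.units_eq_one_or ε with rfl | rfl <;> simp [a, b]
  -- Equal signs are excluded from `F` by the choice of `z`. For opposite signs, membership in `F`
  -- would put `h` in `F₁` or `F₂` by injectivity of `φ`, contradicting reducedness.
  have hmemU : ∀ ε ε' h, h ∈ A → (h ∈ HNNExtension.toSubgroup F₁ F₂ ε → ε = ε') →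
      b ε * φ h * a ε' ∈ U := by
    intro ε ε' h hh hred
    refine ⟨?_, h, hh, ε, ε', rfl⟩
    rcases Int.units_eq_one_or ε with rfl | rfl <;> rcases Int.units_eq_one_or ε' with rfl | rfl
    · intro hmem
      simp only [a, b, if_true, one_mul] at hmem
      exact hzV (Or.inl ⟨h, hh, _, hmem, by simp⟩)
    · rintro ⟨x, hx⟩
      have hx : φ x = φ h := by simpa [a, b, p] using hx
      have hxh : (x : H) = h := hφ (Or.inr (Or.inl x.2)) (Or.inl hh) hx
      exact absurd (hred (hxh ▸ x.2)) (by decide)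
    · rintro ⟨x, hx⟩
      have hx : p x = τ⁻¹ * φ h * τ := by simpa [a, b] using hx
      have hx' : φ (α x) = φ h := by
        change q x = φ h
        rw [← hτp x, hx]
        group
      have hxh : (α x : H) = h := hφ (Or.inr (Or.inr (α x).2)) (Or.inl hh) hx'
      exact absurd (hred (hxh ▸ (α x).2)) (by decide)
    · intro hmem
      have hmem : τ⁻¹ * φ h ∈ F := by simpa [a, b] using hmem
      exact hzV (Or.inr ⟨h, hh, _, F.inv_mem hmem, by simp⟩)
  have hprod : ∀ (l : List (ℤˣ × H)) (ε : ℤˣ) (h : H),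
      ((ε, h) :: l).IsChain
        (fun x y => x.2 ∈ HNNExtension.toSubgroup F₁ F₂ x.1 → x.1 = y.1) →
      (∀ k ∈ ((ε, h) :: l).map Prod.snd, k ∈ A) →
      ∃ l' : List (ℤˣ × G), (∀ x ∈ l', x.2 ∈ U) ∧ ∃ k ∈ K₂,
        (((ε, h) :: l).map fun x => (τ * s) ^ (x.1 : ℤ) * φ x.2).prod =
          a ε * (s ^ (ε : ℤ) * (l'.map fun x => x.2 * s ^ (x.1 : ℤ)).prod) * k⁻¹ := by
    intro l
    induction l with
    | nil =>
      intro ε h _ hA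
      refine ⟨[], by simp, _, ⟨h, hA h (by simp), ε, trivial, rfl⟩, ?_⟩
      simp [hpow, mul_assoc]
    | cons x l ih =>
      obtain ⟨ε', h'⟩ := x
      intro ε h hchain hA
      rw [List.isChain_cons_cons] at hchain
      obtain ⟨l', hl', k, hk, hprod⟩ := ih ε' h' hchain.2
        (fun k hk => hA k (List.mem_cons_of_mem _ hk))
      refine ⟨(ε', b ε * φ h * a ε') :: l', ?_, k, hk, ?_⟩
      · rintro x (_ | ⟨_, hx⟩)
        · exact hmemU ε ε' h (hA h (by simp)) hchain.1
        · exact hl' x hx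
      · rw [List.map_cons, List.prod_cons, hprod, hpow]
        simp [mul_assoc]
  refine ⟨HNNExtension.lift φ (τ * s) hlift, fun y hy hy1 => ?_⟩
  have hyw := hw y
  have hAy : ∀ k ∈ (w y).toList.map Prod.snd, k ∈ A := fun k hk =>
    Set.mem_biUnion hy (Or.inr hk)
  have hheadA : (w y).head ∈ A := Set.mem_biUnion hy (Or.inl rfl)
  have hval : HNNExtension.lift φ (τ * s) hlift y = φ (w y).head *
      ((w y).toList.map fun x => (τ * s) ^ (x.1 : ℤ) * φ x.2).prod := by
    conv_lhs => rw [← hyw]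
    simp [HNNExtension.NormalWord.ReducedWord.prod, map_list_prod, Function.comp_def]
  rw [hy1] at hval
  rcases hl : (w y).toList with _ | ⟨⟨ε, h⟩, l⟩
  · rw [hl, List.map_nil, List.prod_nil, mul_one] at hval
    have h1 : (w y).head = 1 :=
      hφ (Or.inl hheadA) (Or.inr (Or.inl F₁.one_mem)) (by rw [← hval, map_one])
    apply h1Y
    convert hy
    rw [← hyw]
    simp [HNNExtension.NormalWord.ReducedWord.prod, hl, h1]
  · have hchain := (w y).chain
    rw [hl] at hval hAy hchain
    obtain ⟨l', hl', k, hk, hprod'⟩ := hprod l ε h hchain hAy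
    rw [hprod'] at hval
    refine hs l' hl' ε ⟨_, ⟨(w y).head, hheadA, ε, trivial, rfl⟩, k, hk, ?_⟩
    refine (congrArg _ (inv_inv k).symm).trans (inv_mul_inv_eq_of_mul_mul_eq_one ?_)
    rw [hval]
    simp only [mul_assoc]

theorem Monoid.PushoutI.isFullyResidually {G : Type*} [Group G]
    (hG : IsHyperbolicGroup G) (hsat : IsTorsionSaturated G) {X : Bool → Type*} [∀ i, Group (X i)]
    {F : Type*} [Group F] [Finite F] {m : ∀ i, F →* X i} (hm : ∀ i, Function.Injective (m i))
    (hX : ∀ i, IsFullyResidually G (X i)) : IsFullyResidually G (Monoid.PushoutI m) := by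
  refine IsFullyResidually.of_forall_ne_one fun Y hY h1Y => ?_
  choose e w hred hw using Monoid.PushoutI.exists_reduced hm
  let A : ∀ i, Set (X i) := fun i => ⋃ y ∈ Y, {x | (⟨i, x⟩ : Σ i, X i) ∈ (w y).toList}
  have hA : ∀ i, (A i).Finite := fun i => hY.biUnion fun y _ =>
    (List.finite_toSet (w y).toList).preimage (sigma_mk_injective.injOn)
  choose φ hφ using fun i => hX i (A i ∪ Set.range (m i)) ((hA i).union (Set.finite_range _))
  have hinj : ∀ i, Function.Injective ((φ i).comp (m i)) := fun i x y hxy =>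
    hm i (hφ i (Or.inr ⟨x, rfl⟩) (Or.inr ⟨y, rfl⟩) hxy)
  choose g hg using fun i => hsat.exists_conj_eq (hinj i) (hinj true)
  -- after conjugation, the homomorphisms agree on `F`
  let p : F →* G := (φ true).comp (m true)
  have hp : Function.Injective p := hinj true
  let ψ : ∀ i, X i →* G := fun i => (MulAut.conj (g i)).toMonoidHom.comp (φ i)
  have hψm : ∀ i x, ψ i (m i x) = p x := fun i x => hg i x
  have hψ : ∀ i, Set.InjOn (ψ i) (A i ∪ Set.range (m i)) := fun i x hx y hy hxy =>
    hφ i hx hy ((MulAut.conj (g i)).injective hxy)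
  have hP : Finite p.range := Set.finite_range p
  have hψP : ∀ i, ∀ x ∈ A i, x ∉ (m i).range → ψ i x ∉ p.range := by
    rintro i x hx hxm ⟨z, hz⟩
    rw [← hψm i] at hz
    exact hxm ⟨z, hψ i (Or.inr ⟨z, rfl⟩) (Or.inl hx) hz⟩
  let B : Set G := ⋃ i, ψ i '' A i
  have hB : B.Finite := Set.finite_iUnion fun i => (hA i).image _
  let K₁ : Set G := Set.image2 (fun x y => (x * y)⁻¹) p.range (insert 1 B)
  let K₂ : Set G := (·⁻¹) '' insert 1 B
  obtain ⟨s, hsP, hs⟩ := hsat.exists_separating hG p.range (U := B \ p.range)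
    (K := Set.image2 (· * ·) K₁ K₂) hB.sdiff (fun u hu => hu.2)
    (Set.Finite.image2 _ (Set.Finite.image2 _ hP (hB.insert 1)) ((hB.insert 1).image _))
  -- Conjugating only the `true` factor by `s` preserves agreement on `F`, since `s` centralizes
  -- `p.range`.
  let f : ∀ i, X i →* G := fun i =>
    (MulAut.conj (if i = true then s else 1)).toMonoidHom.comp (ψ i)
  have hf1 : ∀ x, f true x = s * ψ true x * s⁻¹ := fun x => by simp [f]
  have hf0 : ∀ x, f false x = ψ false x := fun x => by simp [f]
  have hfm : ∀ i, (f i).comp (m i) = p := by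
    intro i
    ext x
    cases i
    · exact (hf0 _).trans (hψm _ _)
    · refine (hf1 _).trans ?_
      rw [hψm, hsP _ ⟨x, rfl⟩, mul_inv_cancel_right]
  let ε : Bool → ℤˣ := fun i => if i = true then 1 else -1
  -- Letters alternate between factors, so the `s⁻¹` closing a `true` letter precedes the following
  -- `false` letter. The prefix `s⁻¹` in the `false` case is this leftover, and lets the induction
  -- run over both types.
  have hprod : ∀ (l : List (Σ i, X i)) (i : Bool) (x : X i),
      (⟨i, x⟩ :: l).IsChain (fun y z => y.1 ≠ z.1) →
      (∀ y ∈ (⟨i, x⟩ :: l : List (Σ i, X i)), y.2 ∈ A y.1 ∧ y.2 ∉ (m y.1).range) →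
      ∃ l' : List (ℤˣ × G), (∀ y ∈ l', y.2 ∈ B \ p.range) ∧ ∃ k ∈ insert 1 B,
        (if i = true then 1 else s⁻¹) * ((⟨i, x⟩ :: l : List (Σ i, X i)).map
          fun y => f y.1 y.2).prod =
          s ^ (ε i : ℤ) * (l'.map fun y => y.2 * s ^ (y.1 : ℤ)).prod * k := by
    intro l
    induction l with
    | nil =>
      intro i x _ hA
      have hx := hA _ List.mem_cons_self
      have hxB : ψ i x ∈ B := Set.mem_iUnion.2 ⟨i, x, hx.1, rfl⟩
      cases i
      · exact ⟨[], by simp, ψ false x, Or.inr hxB, by simp [hf0, ε]⟩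
      · refine ⟨[(-1, ψ true x)], ?_, 1, Or.inl rfl, by simp [hf1, ε, mul_assoc]⟩
        rintro y (_ | ⟨_, ⟨⟩⟩)
        exact ⟨hxB, hψP _ _ hx.1 hx.2⟩
    | cons z l ih =>
      obtain ⟨j, z⟩ := z
      intro i x hchain hA
      rw [List.isChain_cons_cons] at hchain
      have hx := hA _ List.mem_cons_self
      have hxB : ψ i x ∈ B := Set.mem_iUnion.2 ⟨i, x, hx.1, rfl⟩
      obtain ⟨l', hl', k, hk, hprod⟩ := ih j z hchain.2
        (fun y hy => hA y (List.mem_cons_of_mem _ hy))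
      refine ⟨(ε j, ψ i x) :: l', ?_, k, hk, ?_⟩
      · rintro y (_ | ⟨_, hy⟩)
        · exact ⟨hxB, hψP _ _ hx.1 hx.2⟩
        · exact hl' y hy
      · have hij : i ≠ j := hchain.1
        rw [List.map_cons, List.prod_cons]
        generalize ((⟨j, z⟩ :: l : List (Σ i, X i)).map fun y => f y.1 y.2).prod = Q at hprod ⊢
        cases i <;> cases j
        · exact absurd rfl hij
        · rw [if_pos rfl, one_mul] at hprod
          simp [hprod, hf0, ε, mul_assoc]
        · rw [if_neg Bool.false_ne_true] at hprod
          rw [if_pos rfl, one_mul, hf1, mul_assoc _ s⁻¹, hprod]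
          simp [ε, mul_assoc]
        · exact absurd rfl hij
  refine ⟨Monoid.PushoutI.lift f p hfm, fun y hy hy1 => ?_⟩
  have hyA : ∀ z ∈ (w y).toList, z.2 ∈ A z.1 ∧ z.2 ∉ (m z.1).range := fun z hz =>
    ⟨Set.mem_biUnion hy hz, hred y z hz⟩
  have hval : Monoid.PushoutI.lift f p hfm y =
      p (e y) * ((w y).toList.map fun z => f z.1 z.2).prod := by
    conv_lhs => rw [← hw y]
    simp [Monoid.CoprodI.Word.prod, map_list_prod, Function.comp_def]
  have hchain := (w y).chain_ne
  rw [hy1] at hval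
  -- a word `k₁ * s ^ ε * ⋯ * k₂` of the kind considered above is not trivial
  have hcontra : ∀ k₁ ∈ insert 1 B, ∀ (i : Bool) (l' : List (ℤˣ × G)),
      (∀ y ∈ l', y.2 ∈ B \ p.range) → ∀ k₂ ∈ insert 1 B,
      1 ≠ p (e y) * (k₁ * (s ^ (ε i : ℤ) * (l'.map fun y => y.2 * s ^ (y.1 : ℤ)).prod * k₂)) := by
    intro k₁ hk₁ i l' hl' k₂ hk₂ heq
    refine hs l' hl' (ε i) ⟨_, ⟨p (e y), ⟨e y, rfl⟩, k₁, hk₁, rfl⟩, _, ⟨k₂, hk₂, rfl⟩, ?_⟩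
    refine inv_mul_inv_eq_of_mul_mul_eq_one ?_
    rw [heq]
    simp only [mul_assoc]
  rcases hl : (w y).toList with _ | ⟨⟨i, x⟩, l⟩
  · rw [hl, List.map_nil, List.prod_nil, mul_one] at hval
    have h1 : e y = 1 := hp (hval.symm.trans (map_one p).symm)
    apply h1Y
    convert hy
    rw [← hw y, h1, show w y = Monoid.CoprodI.Word.empty from Monoid.CoprodI.Word.ext hl]
    simp
  · rw [hl] at hval hyA hchain
    have hx := hyA _ List.mem_cons_self
    cases i
    · rw [List.map_cons, List.prod_cons, hf0] at hval
      -- A single `false` letter produces no `s`; its image is nontrivial modulo `p.range` by `hψP`.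
      -- Otherwise a `true` letter follows and the separation applies.
      rcases l with _ | ⟨⟨j, z⟩, l⟩
      · rw [List.map_nil, List.prod_nil, mul_one] at hval
        refine hψP _ _ hx.1 hx.2 ⟨(e y)⁻¹, ?_⟩
        rw [map_inv, inv_eq_iff_mul_eq_one]
        exact hval.symm
      · rw [List.isChain_cons_cons] at hchain
        cases j
        · exact hchain.1 rfl
        · obtain ⟨l', hl', k, hk, hprod'⟩ := hprod l true z hchain.2
            (fun y hy => hyA y (List.mem_cons_of_mem _ hy))
          rw [if_pos rfl, one_mul] at hprod'
          rw [hprod'] at hval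
          exact hcontra _ (Or.inr (Set.mem_iUnion.2 ⟨false, x, hx.1, rfl⟩)) _ l' hl' k hk hval
    · obtain ⟨l', hl', k, hk, hprod'⟩ := hprod l true x hchain hyA
      rw [if_pos rfl, one_mul] at hprod'
      rw [hprod', ← one_mul (s ^ (ε true : ℤ) * _ * k)] at hval
      exact hcontra _ (Or.inl rfl) _ l' hl' k hk hval

theorem mainTheorem8 {G : Type u} [Group G]
    (hG : IsHyperbolicGroup G) (hsat : IsTorsionSaturated G) :
    (∀ (H : Type v) [Group H] (F₁ F₂ : Subgroup H) (α : F₁ ≃* F₂),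
      Finite F₁ → Finite F₂ → IsLimitGroup G H →
        IsLimitGroup G (HNNExtension H F₁ F₂ α)) ∧
    (∀ (A B : Type v) [Group A] [Group B] (F : Type w) [Group F] (i : F →* A) (j : F →* B),
      Finite F → Function.Injective i → Function.Injective j →
        IsLimitGroup G A → IsLimitGroup G B →
          IsLimitGroup G (AmalgamatedProduct i j)) := by
  refine ⟨fun H _ F₁ F₂ α hF₁ _ hH =>
    ⟨HNNExtension.fg hH.1, HNNExtension.isFullyResidually hG hsat α hF₁ hH.2⟩,
    fun A B _ _ F _ i j _ hi hj hA hB => ⟨Monoid.PushoutI.fg ?_,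
      Monoid.PushoutI.isFullyResidually hG hsat ?_ ?_⟩⟩
  · rintro (_ | _)
    exacts [hA.1, hB.1]
  · rintro (_ | _)
    exacts [hi, hj]
  · rintro (_ | _)
    exacts [hA.2, hB.2]
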